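/- Let $H,U,Y,Z$ be real Hilbert spaces, $B\in\mathcal L(U,H)$, $Q\in\mathcal L(H,Y)$, $P\in\mathcal L(H,Z)$, $T>0$, and let $(\mathcal A_\sigma)_{\sigma\in\mathfrak S}$ be a family of operators in $H$, each $\mathcal A_\sigma$ being the infinitesimal generator of a $C_0$-semigroup $(S_\sigma(t))_{t\ge0}$ on $H$. Let $N\ge1$ and let $\Sigma=(\sigma_1,\dots,\sigma_N)$ be a finite sequence in $\mathfrak S$. Let $g\in W^{1,2}(0,T;H)\cap L^2(0,T;\bigcap_{i}\mathcal D(\mathcal A_{\sigma_i}))$ with weak derivative $\dot g$. On the Hilbert product $H^N$ put $\mathcal E z=(z,\dots,z)$, $\mathbf B=\mathcal E B$, $Q_{\rm e}w=(Qw_i)_i$, $P_{\rm e}w=(Pw_i)_i$, $\mathbf A_\Sigma w=(\mathcal A_{\sigma_i}w_i)_i$ with $\mathcal D(\mathbf A_\Sigma)=\prod_i\mathcal D(\mathcal A_{\sigma_i})$, $\mathbf S_\Sigma(t)w=(S_{\sigma_i}(t)w_i)_i$ and $\mathbf f_\Sigma=\mathbf A_\Sigma\mathcal E g-\mathcal E\dot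 g$. A solution $\Pi_\Sigma$ of the Riccati equation for $\Sigma$ is a strongly continuous function on $[0,T]$ with values in the bounded self-adjoint nonnegative operators on $H^N$, such that $\Pi_\Sigma(0)=\frac1N P_{\rm e}^*P_{\rm e}$ and, for all $x,y\in\mathcal D(\mathbf A_\Sigma)$, the function $t\mapsto\langle\Pi_\Sigma(t)x,y\rangle$ is differentiable on $(0,T)$ and, for almost all $t\in(0,T)$, $$\tfrac{d}{dt}\langle\Pi_\Sigma x,y\rangle=\langle\Pi_\Sigma\mathbf A_\Sigma x,y\rangle+\langle\Pi_\Sigma x,\mathbf A_\Sigma y\rangle-\langle\mathbf B^*\Pi_\Sigma x,\mathbf B^*\Pi_\Sigma y\rangle+\tfrac1N\langle Q_{\rm e}x,Q_{\rm e}y\rangle .$$ A solution of the adjoint equation for $\Sigma$ and $\Pi_\Sigma$ is a mild solution $h\in C([0,T];H^N)$ of $-\dot h(t)=(\mathbf A_\Sigma^*-\Pi_\Sigma(T-t)\mathbf B\mathbf B^*)h(t)+\Pi_\Sigma(T-t)\mathbf f_\Sigma(t)$, $h(T)=0$, that is, for all $t\in[0,T]$, $$h(t)=\int_t^T\mathbf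 S_\Sigma(s-t)^*\bigl(\Pi_\Sigma(T-s)\mathbf f_\Sigma(s)-\Pi_\Sigma(T-s)\mathbf B\mathbf B^*h(s)\bigr)\,ds .$$ The associated feedback is $K_\Sigma(t,z)=-\mathbf B^*(\Pi_\Sigma(T-t)\mathcal E z+h(t))$, for $t\in[0,T]$, $z\in H$. Let $\vartheta\in\mathbb R^{N\times N}$ be a permutation matrix, let $\vartheta\Sigma$ be the reordered sequence, and let $\Theta,\Theta^\top\in\mathcal L(H^N)$ be obtained from $\vartheta,\vartheta^\top$ by replacing the entries $1$ by $\mathbf 1_H$ and the entries $0$ by $\mathbf 0_H$. Let $\Pi_\Sigma$ be a solution of the Riccati equation for $\Sigma$ and $h$ a solution of the adjoint equation for $\Sigma$ and $\Pi_\Sigma$. Then: 1. $\Theta\Pi_\Sigma\Theta^\top$ is a solution of the Riccati equation for $\vartheta\Sigma$, and $\Theta h$ is a solution of the adjoint equation for $\vartheta\Sigma$ and $\Theta\Pi_\Sigma\Theta^\top$. 2. Every solution $\Pi_{\vartheta\Sigma}$ of the Riccati equation for $\vartheta\Sigma$ satisfies $\Pi_{\vartheta\Sigma}=\Theta\Pi_\Sigma\Theta^\top$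 on $[0,T]$. 3. For every such $\Pi_{\vartheta\Sigma}$ and every solution $h_\vartheta$ of the adjoint equation for $\vartheta\Sigma$ and $\Pi_{\vartheta\Sigma}$, one has on $[0,T]$: $\Theta^\top h_\vartheta=h$, $\mathbf B^*h_\vartheta=\mathbf B^*h$, and $K_{\vartheta\Sigma}(t,z)=K_\Sigma(t,z)$ for all $z\in H$. That is, the feedback does not depend on the order of the training parameters. -/

import Mathlib

open Set Filter Topology MeasureTheory
open scoped ContDiff

noncomputable section

namespace EnsembleFeedback

/-! ### Strongly continuous semigroups and their generators -/

/-- A strongly continuous semigroup of bounded operators, indexed by the times `t ≥ 0`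
(the values at negative times are irrelevant). -/
structure IsC0Semigroup {X : Type*} [NormedAddCommGroup X] [NormedSpace ℝ X]
    (S : ℝ → X →L[ℝ] X) : Prop where
  map_zero : S 0 = ContinuousLinearMap.id ℝ X
  map_add : ∀ s t : ℝ, 0 ≤ s → 0 ≤ t → S (s + t) = (S s).comp (S t)
  continuousOn : ∀ x : X, ContinuousOn (fun t => S t x) (Ici 0)

/-- `A` is the infinitesimal generator of `S`: `x ∈ D(A)` and `A x = y` hold exactly when
`(S t x - x) / t → y` as `t ↓ 0`. -/
def IsGenerator {X : Type*} [NormedAddCommGroup X] [NormedSpace ℝ X]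
    (S : ℝ → X →L[ℝ] X) (A : X →ₗ.[ℝ] X) : Prop :=
  ∀ x y : X, (x, y) ∈ A.graph ↔
    Tendsto (fun t : ℝ => t⁻¹ • (S t x - x)) (𝓝[>] 0) (𝓝 y)

open Classical in
/-- The value `A x` for `x ∈ D(A)`; the default value `0` is used outside of `D(A)`. -/
def pmapValue {X : Type*} [NormedAddCommGroup X] [NormedSpace ℝ X]
    (A : X →ₗ.[ℝ] X) (x : X) : X :=
  if hx : x ∈ A.domain then A ⟨x, hx⟩ else 0

/-! ### Targets -/

/-- `g ∈ W^{1,2}(0,T;H)`, with weak derivative `g'`. -/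
structure IsW12 {H : Type*} [NormedAddCommGroup H] [NormedSpace ℝ H]
    (T : ℝ) (g g' : ℝ → H) : Prop where
  memLp : MemLp g 2 (volume.restrict (Ioo 0 T))
  memLp_deriv : MemLp g' 2 (volume.restrict (Ioo 0 T))
  weak_deriv : ∀ φ : ℝ → ℝ, ContDiff ℝ ∞ φ → HasCompactSupport φ → tsupport φ ⊆ Ioo 0 T →
    ∫ t in Ioo 0 T, deriv φ t • g t = -∫ t in Ioo 0 T, φ t • g' t

/-- `g ∈ L²(0,T;D(A))`, where `D(A)` carries the graph norm. -/
def IsL2Domain {H : Type*} [NormedAddCommGroup H] [NormedSpace ℝ H]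
    (T : ℝ) (A : H →ₗ.[ℝ] H) (g : ℝ → H) : Prop :=
  MemLp g 2 (volume.restrict (Ioo 0 T)) ∧
    (∀ᵐ t ∂(volume.restrict (Ioo 0 T)), g t ∈ A.domain) ∧
    MemLp (fun t => pmapValue A (g t)) 2 (volume.restrict (Ioo 0 T))

/-! ### The extended system on the Hilbert product `H^N` -/

/-- The Hilbert product `H^N`, with `⟪h, k⟫ = ∑ i, ⟪h i, k i⟫`. -/
abbrev HPow (N : ℕ) (H : Type*) : Type _ := PiLp 2 (fun _ : Fin N => H)

section Extended

variable {H : Type*} [NormedAddCommGroup H] [InnerProductSpace ℝ H]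
variable {X : Type*} [NormedAddCommGroup X] [InnerProductSpace ℝ X]

/-- The `i`-th coordinate `H^N → H`. -/
def coord (N : ℕ) (H : Type*) [NormedAddCommGroup H] [InnerProductSpace ℝ H] (i : Fin N) :
    HPow N H →L[ℝ] H :=
  (ContinuousLinearMap.proj (R := ℝ) (φ := fun _ : Fin N => H) i).comp
    (PiLp.continuousLinearEquiv 2 ℝ (fun _ : Fin N => H)).toContinuousLinearMap

/-- The operator `x ↦ (F 0 x, …, F (N-1) x)` into `X^N`. -/
def tuple {N : ℕ} (F : Fin N → H →L[ℝ] X) : H →L[ℝ] HPow N X :=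
  (PiLp.continuousLinearEquiv 2 ℝ (fun _ : Fin N => X)).symm.toContinuousLinearMap.comp
    (ContinuousLinearMap.pi F)

/-- The extension operator `𝓔 z = (z, …, z)`. -/
def extension (N : ℕ) (H : Type*) [NormedAddCommGroup H] [InnerProductSpace ℝ H] :
    H →L[ℝ] HPow N H :=
  tuple (fun _ => ContinuousLinearMap.id ℝ H)

/-- `L_e (w_1, …, w_N) = (L w_1, …, L w_N)`. -/
def entrywise (N : ℕ) (L : H →L[ℝ] X) : HPow N H →L[ℝ] HPow N X :=
  tuple (fun i => L.comp (coord N H i))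

/-- The operator on `H^N` obtained from a real matrix by replacing each entry `c` by `c • 1_H`. -/
def blockOp {N : ℕ} (H : Type*) [NormedAddCommGroup H] [InnerProductSpace ℝ H]
    (M : Matrix (Fin N) (Fin N) ℝ) : HPow N H →L[ℝ] HPow N H :=
  tuple (fun i => ∑ j, M i j • coord N H j)

/-- The extended operator `(w_i)_i ↦ (A_i w_i)_i`, with domain `∏ i, D(A_i)`. -/
def extOp {N : ℕ} (A : Fin N → H →ₗ.[ℝ] H) : HPow N H →ₗ.[ℝ] HPow N H where
  domain :=
    { carrier := {w | ∀ i, w i ∈ (A i).domain}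
      zero_mem' := fun i => (A i).domain.zero_mem
      add_mem' := fun {_ _} ha hb i => (A i).domain.add_mem (ha i) (hb i)
      smul_mem' := fun c _ ha i => (A i).domain.smul_mem c (ha i) }
  toFun :=
    { toFun := fun w => WithLp.toLp 2 (fun i => A i ⟨w.1 i, w.2 i⟩)
      map_add' := fun v w => by
        ext i
        exact (A i).map_add ⟨v.1 i, v.2 i⟩ ⟨w.1 i, w.2 i⟩
      map_smul' := fun c w => by
        ext i
        exact (A i).map_smul c ⟨w.1 i, w.2 i⟩ }

/-- The extended semigroup `(z_i)_i ↦ (S_i(t) z_i)_i`. -/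
def extSemigroup {N : ℕ} (S : Fin N → ℝ → H →L[ℝ] H) (t : ℝ) : HPow N H →L[ℝ] HPow N H :=
  tuple (fun i => (S i t).comp (coord N H i))

/-- The inhomogeneity `𝐟 = 𝐀 𝓔 g - 𝓔 g'`. -/
def extForcing {N : ℕ} (A : Fin N → H →ₗ.[ℝ] H) (g g' : ℝ → H) (t : ℝ) : HPow N H :=
  pmapValue (extOp A) (extension N H (g t)) - extension N H (g' t)

end Extended

/-! ### Riccati equation, adjoint equation and feedback -/

section Riccati

variable {X U Y Z : Type*}
  [NormedAddCommGroup X] [InnerProductSpace ℝ X] [CompleteSpace X]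
  [NormedAddCommGroup U] [InnerProductSpace ℝ U] [CompleteSpace U]
  [NormedAddCommGroup Y] [InnerProductSpace ℝ Y] [CompleteSpace Y]
  [NormedAddCommGroup Z] [InnerProductSpace ℝ Z] [CompleteSpace Z]

/-- `R` is a strongly continuous function on `[0,T]` with values in the bounded self-adjoint
nonnegative operators, and it solves, in the weak sense on `D(A) × D(A)`,
`R' = R A + A* R - R B B* R + c Q* Q` on `(0,T)`, `R(0) = c P* P`. -/
structure IsRiccatiSolution (T c : ℝ) (A : X →ₗ.[ℝ] X) (B : U →L[ℝ] X)
    (Q : X →L[ℝ] Y) (P : X →L[ℝ] Z) (R : ℝ → X →L[ℝ] X) : Prop where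
  continuousOn : ∀ x : X, ContinuousOn (fun t => R t x) (Icc 0 T)
  isPositive : ∀ t ∈ Icc 0 T, (R t).IsPositive
  differentiableAt : ∀ x y : A.domain, ∀ t ∈ Ioo 0 T,
    DifferentiableAt ℝ (fun s => inner ℝ (R s (x : X)) (y : X)) t
  equation : ∀ x y : A.domain, ∀ᵐ t ∂(volume.restrict (Ioo 0 T)),
    deriv (fun s => inner ℝ (R s (x : X)) (y : X)) t =
      inner ℝ (R t (A x)) (y : X) + inner ℝ (R t (x : X)) (A y)
        - inner ℝ (B.adjoint (R t (x : X))) (B.adjoint (R t (y : X)))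
        + c * inner ℝ (Q (x : X)) (Q (y : X))
  initial : R 0 = c • P.adjoint.comp P

/-- `h ∈ C([0,T];X)` is the mild solution of the backward equation
`-h' = (A* - R(T-t) B B*) h + R(T-t) f`, `h(T) = 0`, where `A` generates `S`. -/
structure IsAdjointSolution (T : ℝ) (S : ℝ → X →L[ℝ] X) (B : U →L[ℝ] X)
    (R : ℝ → X →L[ℝ] X) (f h : ℝ → X) : Prop where
  continuousOn : ContinuousOn h (Icc 0 T)
  terminal : h T = 0
  integrable : ∀ t ∈ Icc 0 T, IntervalIntegrable
    (fun s => (S (s - t)).adjoint (R (T - s) (f s) - R (T - s) (B (B.adjoint (h s)))))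
    volume t T
  equation : ∀ t ∈ Icc 0 T, h t =
    ∫ s in t..T, (S (s - t)).adjoint (R (T - s) (f s) - R (T - s) (B (B.adjoint (h s))))

end Riccati

/-- `R` solves the Riccati equation of the extended system of the operators `A_1, …, A_N`:
`R' = R 𝐀 + 𝐀* R - R 𝐁 𝐁* R + (1/N) Q_e* Q_e`, `R(0) = (1/N) P_e* P_e`, with `𝐁 = 𝓔 B`. -/
def IsEnsembleRiccati {H U Y Z : Type*}
    [NormedAddCommGroup H] [InnerProductSpace ℝ H] [CompleteSpace H]
    [NormedAddCommGroup U] [InnerProductSpace ℝ U] [CompleteSpace U]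
    [NormedAddCommGroup Y] [InnerProductSpace ℝ Y] [CompleteSpace Y]
    [NormedAddCommGroup Z] [InnerProductSpace ℝ Z] [CompleteSpace Z] {N : ℕ}
    (T : ℝ) (A : Fin N → H →ₗ.[ℝ] H) (B : U →L[ℝ] H) (Q : H →L[ℝ] Y) (P : H →L[ℝ] Z)
    (R : ℝ → HPow N H →L[ℝ] HPow N H) : Prop :=
  IsRiccatiSolution T (1 / N : ℝ) (extOp A) ((extension N H).comp B)
    (entrywise N Q) (entrywise N P) R

/-- `h` solves the adjoint equation of the extended system, for the Riccati operator `R`: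
`-h' = (𝐀* - R(T-t) 𝐁 𝐁*) h + R(T-t) 𝐟`, `h(T) = 0`, with `𝐟 = 𝐀 𝓔 g - 𝓔 g'`;
here `A_i` generates `S_i`. -/
def IsEnsembleAdjoint {H U : Type*}
    [NormedAddCommGroup H] [InnerProductSpace ℝ H] [CompleteSpace H]
    [NormedAddCommGroup U] [InnerProductSpace ℝ U] [CompleteSpace U] {N : ℕ}
    (T : ℝ) (A : Fin N → H →ₗ.[ℝ] H) (S : Fin N → ℝ → H →L[ℝ] H) (B : U →L[ℝ] H)
    (g g' : ℝ → H) (R : ℝ → HPow N H →L[ℝ] HPow N H) (h : ℝ → HPow N H) : Prop :=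
  IsAdjointSolution T (extSemigroup S) ((extension N H).comp B) R (extForcing A g g') h

/-- The feedback `K(t,z) = -𝐁* (Π(T-t) 𝓔 z + h(t))`, with `𝐁 = 𝓔 B`. -/
def feedback {H U : Type*} [NormedAddCommGroup H] [InnerProductSpace ℝ H] [CompleteSpace H]
    [NormedAddCommGroup U] [InnerProductSpace ℝ U] [CompleteSpace U] {N : ℕ}
    (T : ℝ) (B : U →L[ℝ] H) (R : ℝ → HPow N H →L[ℝ] HPow N H) (h : ℝ → HPow N H)
    (t : ℝ) (z : H) : U :=
  -(((extension N H).comp B).adjoint (R (T - t) (extension N H z) + h t))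

end EnsembleFeedback

end

open EnsembleFeedback

/-!
Reordering the ensemble is conjugation by a unitary operator, and the Riccati equation and the
adjoint equation each have at most one solution.

*Covariance.* The matrix of a permutation `π` acts on `H^N` as the unitary `V w = w ∘ π`
(`permuteCoords`), and the extended operators of the reordered ensemble are `V 𝐀 V*`, `V 𝐒 V*` and
`V 𝐟`. Since `V 𝓔 = 𝓔`, the control operator `𝐁 = 𝓔 B` is unchanged, and the quadratic forms of
`Q_e` and `P_e` are sums over the coordinates, so they are invariant under `V`. Hence `V R V*` and
`V h` solve the reordered equations (`IsRiccatiSolution.conj_unitary`,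
`IsAdjointSolution.conj_unitary`).

*Uniqueness for the Riccati equation* (`IsRiccatiSolution.eqOn`). If `A` generates `S` and
`x, y ∈ D(A)`, the derivative of `s ↦ ⟪R s (S (t - s) x), S (t - s) y⟫` contains only the
bounded terms of the equation. For the difference `D` of two solutions, integration over `[0, t]`
gives `|⟪D t x, y⟫| ≤ C ∫₀ᵗ ‖D s‖ ds ‖x‖ ‖y‖`. As `D(A)` is dense, this bounds `‖D t‖`, and
Gronwall's inequality yields `D = 0`. The function `‖D s‖` need not be continuous for a strongly continuous
`D`, so the inequality is used in a form with continuous majorants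
(`nonpos_of_le_integral_of_dominated`).

*Uniqueness for the adjoint equation* (`IsAdjointSolution.eqOn`). The difference of two mild
solutions satisfies a homogeneous linear Volterra equation with bounded kernel, and Gronwall's
inequality applies in reversed time.

The feedback does not change because `𝐁* V = 𝐁*` and `V* 𝓔 = 𝓔`.
-/

namespace EnsembleFeedback

/-! ### Strongly continuous operator functions -/

section StrongContinuity

variable {X Y : Type*} [NormedAddCommGroup X] [NormedSpace ℝ X]
  [NormedAddCommGroup Y] [NormedSpace ℝ Y]

theorem exists_norm_le_of_strongly_continuousOn [CompleteSpace X] {F : ℝ → X →L[ℝ] Y} {K : Set ℝ}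
    (hK : IsCompact K) (hF : ∀ x, ContinuousOn (fun t => F t x) K) :
    ∃ C, 0 ≤ C ∧ ∀ t ∈ K, ‖F t‖ ≤ C := by
  obtain ⟨C, hC⟩ := banach_steinhaus (g := fun t : K => F t) fun x => by
    obtain ⟨C, hC⟩ := hK.exists_bound_of_continuousOn (hF x)
    exact ⟨C, fun t => hC t t.2⟩
  exact ⟨max C 0, le_max_right _ _, fun t ht => (hC ⟨t, ht⟩).trans (le_max_left _ _)⟩

theorem tendsto_clm_apply_of_norm_le {ι : Type*} {l : Filter ι} {F : ι → X →L[ℝ] Y} {v : ι → X}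
    {x : X} {y : Y} {C : ℝ} (hC : ∀ᶠ a in l, ‖F a‖ ≤ C) (hF : Tendsto (fun a => F a x) l (𝓝 y))
    (hv : Tendsto v l (𝓝 x)) : Tendsto (fun a => F a (v a)) l (𝓝 y) := by
  have h0 : Tendsto (fun a => F a (v a - x)) l (𝓝 0) := by
    have hv0 : Tendsto (fun a => C * ‖v a - x‖) l (𝓝 0) := by
      have := (tendsto_iff_norm_sub_tendsto_zero.1 hv).const_mul C
      rwa [mul_zero] at this
    refine squeeze_zero_norm' ?_ hv0
    filter_upwards [hC] with a ha
    exact (F a).le_of_opNorm_le ha _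
  simpa using h0.add hF

theorem continuousOn_clm_apply_of_strongly_continuousOn [CompleteSpace X] {F : ℝ → X →L[ℝ] Y}
    {K : Set ℝ} (hK : IsCompact K) (hF : ∀ x, ContinuousOn (fun t => F t x) K) {v : ℝ → X}
    (hv : ContinuousOn v K) : ContinuousOn (fun t => F t (v t)) K := by
  obtain ⟨C, -, hC⟩ := exists_norm_le_of_strongly_continuousOn hK hF
  intro t ht
  exact tendsto_clm_apply_of_norm_le (eventually_nhdsWithin_of_forall hC) (hF (v t) t ht) (hv t ht)

end StrongContinuity

/-- Product rule for `⟪F u, v⟫`, where the operator function `F` is only strongly continuous and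
only the form `⟪F x, y⟫` at the point `(u s, v s)` is differentiable. -/
theorem hasDerivAt_inner_clm_apply {X : Type*} [NormedAddCommGroup X] [InnerProductSpace ℝ X]
    {F : ℝ → X →L[ℝ] X} {u v : ℝ → X} {u' v' : X} {d s C : ℝ}
    (hC : ∀ᶠ r in 𝓝 s, ‖F r‖ ≤ C) (hF : ∀ x, ContinuousAt (fun r => F r x) s)
    (hu : HasDerivAt u u' s) (hv : HasDerivAt v v' s)
    (hd : HasDerivAt (fun r => inner ℝ (F r (u s)) (v s)) d s) :
    HasDerivAt (fun r => inner ℝ (F r (u r)) (v r))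
      (inner ℝ (F s u') (v s) + inner ℝ (F s (u s)) v' + d) s := by
  rw [hasDerivAt_iff_tendsto_slope] at *
  have hle : 𝓝[≠] s ≤ 𝓝 s := nhdsWithin_le_nhds
  have hvs : ContinuousAt v s := (hasDerivAt_iff_tendsto_slope.2 hv).continuousAt
  have h1 : Tendsto (fun r => inner ℝ (F r (slope u s r)) (v r)) (𝓝[≠] s)
      (𝓝 (inner ℝ (F s u') (v s))) :=
    (tendsto_clm_apply_of_norm_le (hle hC) ((hF u').mono_left hle) hu).inner (hvs.mono_left hle)
  have h2 : Tendsto (fun r => inner ℝ (F r (u s)) (slope v s r)) (𝓝[≠] s)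
      (𝓝 (inner ℝ (F s (u s)) v')) := ((hF (u s)).mono_left hle).inner hv
  refine ((h1.add h2).add hd).congr fun r => ?_
  simp only [slope_def_module, map_smul, map_sub, inner_smul_left, inner_smul_right,
    inner_sub_left, inner_sub_right, smul_eq_mul, RCLike.conj_to_real]
  ring

/-! ### A Gronwall inequality without measurability -/

/-- Gronwall's inequality for a bounded function `φ` with `φ t ≤ C ∫₀ᵗ φ`, where the integral is
replaced by the integrals of the continuous functions dominating `φ`, so that no measurability
of `φ` is needed. -/
theorem nonpos_of_le_integral_of_dominated {φ : ℝ → ℝ} {T C K : ℝ} (hC : 0 ≤ C) (hK : 0 ≤ K)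
    (hφK : ∀ t ∈ Icc 0 T, φ t ≤ K)
    (hφ : ∀ b : ℝ → ℝ, Continuous b → (∀ t ∈ Icc 0 T, φ t ≤ b t) →
      ∀ t ∈ Icc 0 T, φ t ≤ C * ∫ s in 0..t, b s) :
    ∀ t ∈ Icc 0 T, φ t ≤ 0 := by
  -- Each use of the hypothesis halves the constant in a bound by `exp (l t)`, for `l ≥ 2 C`.
  set l : ℝ := 2 * C + 1 with hl
  have hl0 : 0 < l := by positivity
  have key : ∀ n : ℕ, ∀ t ∈ Icc 0 T, φ t ≤ K / 2 ^ n * Real.exp (l * t) := by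
    intro n
    induction n with
    | zero =>
      intro t ht
      have : 1 ≤ Real.exp (l * t) := Real.one_le_exp (mul_nonneg hl0.le ht.1)
      have := hφK t ht
      simp only [pow_zero, div_one]
      nlinarith
    | succ n ih =>
      intro t ht
      refine (hφ _ (by fun_prop) ih t ht).trans ?_
      have hint : ∫ s in 0..t, K / 2 ^ n * Real.exp (l * s)
          = K / 2 ^ n * (l⁻¹ * (Real.exp (l * t) - 1)) := by
        rw [intervalIntegral.integral_const_mul, intervalIntegral.integral_comp_mul_left
          (fun s => Real.exp s) hl0.ne', integral_exp]
        simp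
      rw [hint, pow_succ]
      have hCl : C * l⁻¹ ≤ 1 / 2 := by
        rw [← div_eq_mul_inv, div_le_iff₀ hl0]
        linarith
      have he : 0 ≤ Real.exp (l * t) - 1 := by
        linarith [Real.one_le_exp (mul_nonneg hl0.le ht.1)]
      calc C * (K / 2 ^ n * (l⁻¹ * (Real.exp (l * t) - 1)))
          = K / 2 ^ n * ((C * l⁻¹) * (Real.exp (l * t) - 1)) := by ring
        _ ≤ K / 2 ^ n * (1 / 2 * Real.exp (l * t)) := by
            gcongr
            linarith
        _ = K / (2 ^ n * 2) * Real.exp (l * t) := by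
            field_simp
  intro t ht
  have hlim : Tendsto (fun n : ℕ => K / 2 ^ n * Real.exp (l * t)) atTop (𝓝 0) := by
    have := (tendsto_pow_atTop_nhds_zero_of_lt_one (r := (1 / 2 : ℝ)) (by norm_num)
      (by norm_num)).const_mul (K * Real.exp (l * t))
    rw [mul_zero] at this
    refine this.congr fun n => ?_
    rw [one_div, inv_pow]
    ring
  exact ge_of_tendsto' hlim fun n => key n t ht

/-! ### Semigroups and their generators -/

section Semigroup

variable {X : Type*} [NormedAddCommGroup X] [NormedSpace ℝ X] {S : ℝ → X →L[ℝ] X}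
  {A : X →ₗ.[ℝ] X}

theorem IsC0Semigroup.continuous_max (hS : IsC0Semigroup S) (x : X) :
    Continuous (fun t => S (max t 0) x) :=
  (hS.continuousOn x).comp_continuous (by fun_prop) fun _ => mem_Ici.2 (le_max_right _ _)

theorem IsC0Semigroup.exists_norm_le [CompleteSpace X] (hS : IsC0Semigroup S) (T : ℝ) :
    ∃ M, 0 ≤ M ∧ ∀ t ∈ Icc 0 T, ‖S t‖ ≤ M :=
  exists_norm_le_of_strongly_continuousOn isCompact_Icc fun x =>
    (hS.continuousOn x).mono Icc_subset_Ici_self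

theorem IsGenerator.apply_mem_graph (hS : IsC0Semigroup S) (hA : IsGenerator S A) {x y : X}
    (hxy : (x, y) ∈ A.graph) {t : ℝ} (ht : 0 ≤ t) : (S t x, S t y) ∈ A.graph := by
  rw [hA] at hxy ⊢
  refine (((S t).continuous.tendsto y).comp hxy).congr' ?_
  filter_upwards [self_mem_nhdsWithin] with h (hh : 0 < h)
  simp only [Function.comp_apply, map_smul, map_sub]
  rw [← ContinuousLinearMap.comp_apply, ← hS.map_add t h ht hh.le, add_comm t h,
    hS.map_add h t hh.le ht, ContinuousLinearMap.comp_apply]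

/-- The orbit of a point of the domain has a two-sided derivative. The right derivative comes from
the semigroup law; since it is continuous, the orbit is its primitive. -/
theorem IsGenerator.hasDerivAt_apply [CompleteSpace X] (hS : IsC0Semigroup S)
    (hA : IsGenerator S A) {x y : X}
    (hxy : (x, y) ∈ A.graph) {t : ℝ} (ht : 0 < t) : HasDerivAt (fun s => S s x) (S t y) t := by
  have hright : ∀ s : ℝ, 0 ≤ s → HasDerivWithinAt (fun r => S r x) (S s y) (Ioi s) s := by
    intro s hs
    have hlim := (hA _ _).1 (hA.apply_mem_graph hS hxy hs)
    rw [hasDerivWithinAt_iff_tendsto_slope' (by simp)]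
    have hshift : Tendsto (fun r => r - s) (𝓝[>] s) (𝓝[>] 0) := by
      refine tendsto_nhdsWithin_iff.2 ⟨?_, ?_⟩
      · have : Tendsto (fun r => r - s) (𝓝 s) (𝓝 (s - s)) :=
          (continuous_sub_right s).tendsto s
        rw [sub_self] at this
        exact this.mono_left nhdsWithin_le_nhds
      · filter_upwards [self_mem_nhdsWithin] with r (hr : s < r)
        exact sub_pos.2 hr
    refine (hlim.comp hshift).congr' ?_
    filter_upwards [self_mem_nhdsWithin] with r (hr : s < r)
    simp only [Function.comp_apply, slope_def_module]
    rw [← ContinuousLinearMap.comp_apply, ← hS.map_add _ _ (sub_pos.2 hr).le hs, sub_add_cancel]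
  have hc := hS.continuous_max y
  have hprim : ∀ s : ℝ, 0 ≤ s → S s x = x + ∫ r in 0..s, S (max r 0) y := by
    intro s hs
    rw [intervalIntegral.integral_eq_sub_of_hasDeriv_right_of_le (f := fun r => S r x) hs
      ((hS.continuousOn x).mono Icc_subset_Ici_self) (fun r hr => ?_) (hc.intervalIntegrable _ _),
      hS.map_zero]
    · simp
    · rw [max_eq_left hr.1.le]
      exact hright r hr.1.le
  have hder := (intervalIntegral.integral_hasDerivAt_right (hc.intervalIntegrable 0 t)
    hc.stronglyMeasurable.stronglyMeasurableAtFilter hc.continuousAt).const_add x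
  rw [max_eq_left ht.le] at hder
  refine hder.congr_of_eventuallyEq ?_
  filter_upwards [lt_mem_nhds ht] with s hs
  exact hprim s hs.le

/-- The domain of the generator is dense: it contains the means `t⁻¹ ∫₀ᵗ S s x ds`. -/
theorem IsGenerator.dense_domain [CompleteSpace X] (hS : IsC0Semigroup S) (hA : IsGenerator S A) :
    Dense (A.domain : Set X) := by
  intro x
  set u : ℝ → X := fun s => S (max s 0) x with hu
  have huc : Continuous u := hS.continuous_max x
  set F : ℝ → X := fun t => ∫ s in 0..t, u s with hFdef
  have hF : ∀ t, HasDerivAt F (u t) t := fun t =>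
    intervalIntegral.integral_hasDerivAt_right (huc.intervalIntegrable 0 t)
      huc.stronglyMeasurable.stronglyMeasurableAtFilter huc.continuousAt
  have hF0 : F 0 = 0 := by simp [hFdef]
  have hu0 : u 0 = x := by simp [hu, hS.map_zero]
  have hmem : ∀ t : ℝ, 0 < t → F t ∈ A.domain := by
    intro t ht
    have hlim : (F t, u t - u 0) ∈ A.graph := by
      rw [hA]
      refine ((hF t).tendsto_slope_zero_right.sub (hF 0).tendsto_slope_zero_right).congr' ?_
      filter_upwards [self_mem_nhdsWithin] with h (hh : 0 < h)
      have hSF : S h (F t) = F (t + h) - F h := by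
        have h1 : S h (F t) = ∫ s in 0..t, u (s + h) := by
          rw [hFdef, ← (S h).intervalIntegral_comp_comm (huc.intervalIntegrable 0 t)]
          refine intervalIntegral.integral_congr fun s hs => ?_
          rw [uIcc_of_le ht.le] at hs
          simp only [hu]
          rw [max_eq_left hs.1, max_eq_left (add_nonneg hs.1 hh.le), add_comm s h,
            hS.map_add h s hh.le hs.1, ContinuousLinearMap.comp_apply]
        rw [h1, intervalIntegral.integral_comp_add_right, zero_add]
        exact (intervalIntegral.integral_interval_sub_left (huc.intervalIntegrable _ _)
          (huc.intervalIntegrable _ _)).symm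
      rw [hSF, ← smul_sub, zero_add, hF0]
      congr 1
      abel
    exact LinearPMap.mem_domain_of_mem_graph hlim
  have hlim := (hF 0).tendsto_slope_zero_right
  rw [hu0] at hlim
  refine mem_closure_of_tendsto hlim ?_
  filter_upwards [self_mem_nhdsWithin] with t (ht : 0 < t)
  rw [zero_add, hF0, sub_zero]
  exact A.domain.smul_mem _ (hmem t ht)

end Semigroup

section Uniqueness

variable {X U Y Z : Type*}
  [NormedAddCommGroup X] [InnerProductSpace ℝ X] [CompleteSpace X]
  [NormedAddCommGroup U] [InnerProductSpace ℝ U] [CompleteSpace U]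
  [NormedAddCommGroup Y] [InnerProductSpace ℝ Y]
  [NormedAddCommGroup Z] [InnerProductSpace ℝ Z] [CompleteSpace Z]
  {T c : ℝ} {S : ℝ → X →L[ℝ] X} {A : X →ₗ.[ℝ] X} {B : U →L[ℝ] X}
  {Q : X →L[ℝ] Y} {P : X →L[ℝ] Z} {R R₁ R₂ : ℝ → X →L[ℝ] X}

/-! ### Uniqueness for the Riccati equation -/

/-- The Riccati equation, required almost everywhere, holds at every time: its right-hand side is
continuous, and an everywhere differentiable function with integrable derivative is a primitive
of it. -/
theorem IsRiccatiSolution.hasDerivAt (hR : IsRiccatiSolution T c A B Q P R) (x y : A.domain)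
    {t : ℝ} (ht : t ∈ Ioo 0 T) :
    HasDerivAt (fun s => inner ℝ (R s (x : X)) (y : X))
      (inner ℝ (R t (A x)) (y : X) + inner ℝ (R t (x : X)) (A y)
        - inner ℝ (B.adjoint (R t (x : X))) (B.adjoint (R t (y : X)))
        + c * inner ℝ (Q (x : X)) (Q (y : X))) t := by
  set f : ℝ → ℝ := fun s => inner ℝ (R s (x : X)) (y : X) with hf
  set G : ℝ → ℝ := fun t => inner ℝ (R t (A x)) (y : X) + inner ℝ (R t (x : X)) (A y)
        - inner ℝ (B.adjoint (R t (x : X))) (B.adjoint (R t (y : X)))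
        + c * inner ℝ (Q (x : X)) (Q (y : X)) with hG
  have hGc : ContinuousOn G (Icc 0 T) :=
    ((((hR.continuousOn _).inner continuousOn_const).add
      ((hR.continuousOn _).inner continuousOn_const)).sub
      ((B.adjoint.continuous.comp_continuousOn (hR.continuousOn _)).inner
        (B.adjoint.continuous.comp_continuousOn (hR.continuousOn _)))).add continuousOn_const
  have hfc : ContinuousOn f (Icc 0 T) := (hR.continuousOn _).inner continuousOn_const
  have hae : ∀ᵐ s, s ∈ Ioo 0 T → deriv f s = G s :=
    (ae_restrict_iff' measurableSet_Ioo).1 (hR.equation x y)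
  have hprim : ∀ s ∈ Ioo 0 T, f s = f 0 + ∫ r in 0..s, G r := by
    intro s hs
    have hsub : Icc 0 s ⊆ Icc 0 T := Icc_subset_Icc_right hs.2.le
    have haes : ∀ᵐ r, r ∈ uIoc 0 s → G r = deriv f r := by
      filter_upwards [hae] with r hr hrs
      rw [uIoc_of_le hs.1.le] at hrs
      exact (hr ⟨hrs.1, hrs.2.trans_lt hs.2⟩).symm
    have hGi : IntervalIntegrable G volume 0 s :=
      (hGc.mono hsub).intervalIntegrable_of_Icc hs.1.le
    rw [intervalIntegral.integral_congr_ae haes,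
      intervalIntegral.integral_eq_sub_of_hasDerivAt_of_le hs.1.le (hfc.mono hsub)
        (fun r hr => (hR.differentiableAt x y r ⟨hr.1, hr.2.trans hs.2⟩).hasDerivAt)
        (hGi.congr_ae ((ae_restrict_iff' measurableSet_uIoc).2 haes))]
    ring
  have hnhds : Icc 0 T ∈ 𝓝 t := Icc_mem_nhds ht.1 ht.2
  have hder := (intervalIntegral.integral_hasDerivAt_right
    ((hGc.mono (Icc_subset_Icc_right ht.2.le)).intervalIntegrable_of_Icc ht.1.le)
    (hGc.mono Ioo_subset_Icc_self |>.stronglyMeasurableAtFilter isOpen_Ioo t ht)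
    (hGc.continuousAt hnhds)).const_add (f 0)
  refine hder.congr_of_eventuallyEq ?_
  filter_upwards [Ioo_mem_nhds ht.1 ht.2] with s hs
  exact hprim s hs

/-- The Riccati equation along the orbits of the semigroup: in the derivative of
`⟪R s (S (t - s) x), S (t - s) y⟫` the unbounded terms cancel. -/
theorem IsRiccatiSolution.hasDerivAt_orbit (hS : IsC0Semigroup S) (hA : IsGenerator S A)
    (hR : IsRiccatiSolution T c A B Q P R) {x y : X} (hx : x ∈ A.domain) (hy : y ∈ A.domain)
    {t s : ℝ} (hs : 0 < s) (hst : s < t) (htT : t ≤ T) :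
    HasDerivAt (fun s => inner ℝ (R s (S (t - s) x)) (S (t - s) y))
      (-inner ℝ (B.adjoint (R s (S (t - s) x))) (B.adjoint (R s (S (t - s) y)))
        + c * inner ℝ (Q (S (t - s) x)) (Q (S (t - s) y))) s := by
  have hgx := A.mem_graph ⟨x, hx⟩
  have hgy := A.mem_graph ⟨y, hy⟩
  have hts : 0 < t - s := sub_pos.2 hst
  obtain ⟨x', hx', hAx⟩ := A.mem_graph_iff.1 (hA.apply_mem_graph hS hgx hts.le)
  obtain ⟨y', hy', hAy⟩ := A.mem_graph_iff.1 (hA.apply_mem_graph hS hgy hts.le)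
  have hux : HasDerivAt (fun r => S (t - r) x) (-(A x')) s := by
    rw [hAx]
    exact (hA.hasDerivAt_apply hS hgx hts).comp_const_sub t s
  have huy : HasDerivAt (fun r => S (t - r) y) (-(A y')) s := by
    rw [hAy]
    exact (hA.hasDerivAt_apply hS hgy hts).comp_const_sub t s
  have hmem : s ∈ Ioo 0 T := ⟨hs, hst.trans_le htT⟩
  have hnhds : Icc 0 T ∈ 𝓝 s := Icc_mem_nhds hmem.1 hmem.2
  obtain ⟨C, -, hC⟩ := exists_norm_le_of_strongly_continuousOn isCompact_Icc hR.continuousOn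
  have hd := hR.hasDerivAt x' y' hmem
  simp only [] at hx' hy'
  rw [hx', hy'] at hd
  have hprod := hasDerivAt_inner_clm_apply (mem_of_superset hnhds hC)
    (fun z => (hR.continuousOn z).continuousAt hnhds) hux huy hd
  convert hprod using 1
  simp only [map_neg, inner_neg_left, inner_neg_right]
  ring

theorem IsRiccatiSolution.eqOn (hS : IsC0Semigroup S) (hA : IsGenerator S A)
    (h₁ : IsRiccatiSolution T c A B Q P R₁) (h₂ : IsRiccatiSolution T c A B Q P R₂) :
    ∀ t ∈ Icc 0 T, R₁ t = R₂ t := by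
  obtain ⟨M, hM0, hM⟩ := hS.exists_norm_le T
  obtain ⟨K₁, hK₁0, hK₁⟩ :=
    exists_norm_le_of_strongly_continuousOn isCompact_Icc h₁.continuousOn
  obtain ⟨K₂, hK₂0, hK₂⟩ :=
    exists_norm_le_of_strongly_continuousOn isCompact_Icc h₂.continuousOn
  set β := ‖B.adjoint‖ with hβ
  have hβ0 : 0 ≤ β := norm_nonneg _
  set C : ℝ := β * β * (K₁ + K₂) * (M * M) with hCdef
  have hC0 : 0 ≤ C := by positivity
  -- Difference of the quadratic terms, linear in `R₁ - R₂`.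
  have hquad : ∀ s ∈ Icc 0 T, ∀ u v : X,
      |inner ℝ (B.adjoint (R₁ s u)) (B.adjoint (R₁ s v))
        - inner ℝ (B.adjoint (R₂ s u)) (B.adjoint (R₂ s v))|
      ≤ β * β * (K₁ + K₂) * ‖R₁ s - R₂ s‖ * (‖u‖ * ‖v‖) := by
    intro s hs u v
    have hBn : ∀ w, ‖B.adjoint w‖ ≤ β * ‖w‖ := fun w => B.adjoint.le_opNorm w
    have hDn : ∀ w, ‖B.adjoint ((R₁ s - R₂ s) w)‖ ≤ β * (‖R₁ s - R₂ s‖ * ‖w‖) := fun w =>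
      (hBn _).trans (by gcongr; exact (R₁ s - R₂ s).le_opNorm w)
    have h1n : ‖B.adjoint (R₁ s v)‖ ≤ β * (K₁ * ‖v‖) :=
      (hBn _).trans (by gcongr; exact (R₁ s).le_of_opNorm_le (hK₁ s hs) v)
    have h2n : ‖B.adjoint (R₂ s u)‖ ≤ β * (K₂ * ‖u‖) :=
      (hBn _).trans (by gcongr; exact (R₂ s).le_of_opNorm_le (hK₂ s hs) u)
    have hsplit : inner ℝ (B.adjoint (R₁ s u)) (B.adjoint (R₁ s v))
        - inner ℝ (B.adjoint (R₂ s u)) (B.adjoint (R₂ s v))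
        = inner ℝ (B.adjoint ((R₁ s - R₂ s) u)) (B.adjoint (R₁ s v))
          + inner ℝ (B.adjoint (R₂ s u)) (B.adjoint ((R₁ s - R₂ s) v)) := by
      simp only [sub_apply, map_sub, inner_sub_left, inner_sub_right]
      ring
    rw [hsplit]
    calc _ ≤ ‖B.adjoint ((R₁ s - R₂ s) u)‖ * ‖B.adjoint (R₁ s v)‖
          + ‖B.adjoint (R₂ s u)‖ * ‖B.adjoint ((R₁ s - R₂ s) v)‖ :=
        (abs_add_le _ _).trans (add_le_add (abs_real_inner_le_norm _ _)
          (abs_real_inner_le_norm _ _))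
      _ ≤ β * (‖R₁ s - R₂ s‖ * ‖u‖) * (β * (K₁ * ‖v‖))
          + β * (K₂ * ‖u‖) * (β * (‖R₁ s - R₂ s‖ * ‖v‖)) := by
        gcongr
        · exact hDn u
        · exact hDn v
      _ = _ := by ring
  suffices h : ∀ t ∈ Icc 0 T, ‖R₁ t - R₂ t‖ ≤ 0 from fun t ht =>
    sub_eq_zero.1 (norm_le_zero_iff.1 (h t ht))
  refine nonpos_of_le_integral_of_dominated hC0 (add_nonneg hK₁0 hK₂0)
    (fun t ht => (norm_sub_le _ _).trans (add_le_add (hK₁ t ht) (hK₂ t ht))) ?_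
  intro b hb hbd t ht
  have hsub : Icc 0 t ⊆ Icc 0 T := Icc_subset_Icc_right ht.2
  have hI0 : 0 ≤ ∫ s in 0..t, b s :=
    intervalIntegral.integral_nonneg ht.1 fun s hs => (norm_nonneg _).trans (hbd s (hsub hs))
  have hdom : ∀ x ∈ A.domain, ∀ y ∈ A.domain,
      ‖inner ℝ ((R₁ t - R₂ t) x) y‖ ≤ (C * ∫ s in 0..t, b s) * ‖x‖ * ‖y‖ := by
    intro x hx y hy
    have hu : ∀ z : X, ContinuousOn (fun s => S (t - s) z) (Icc 0 t) := fun z =>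
      (hS.continuousOn z).comp (by fun_prop) fun s hs => mem_Ici.2 (sub_nonneg.2 hs.2)
    have hc₁ : ∀ z : X, ContinuousOn (fun s => R₁ s (S (t - s) z)) (Icc 0 t) := fun z =>
      continuousOn_clm_apply_of_strongly_continuousOn isCompact_Icc
        (fun w => (h₁.continuousOn w).mono hsub) (hu z)
    have hc₂ : ∀ z : X, ContinuousOn (fun s => R₂ s (S (t - s) z)) (Icc 0 t) := fun z =>
      continuousOn_clm_apply_of_strongly_continuousOn isCompact_Icc
        (fun w => (h₂.continuousOn w).mono hsub) (hu z)
    set q : ℝ → ℝ := fun s =>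
      inner ℝ (B.adjoint (R₁ s (S (t - s) x))) (B.adjoint (R₁ s (S (t - s) y)))
        - inner ℝ (B.adjoint (R₂ s (S (t - s) x))) (B.adjoint (R₂ s (S (t - s) y))) with hq
    have hqc : ContinuousOn q (Icc 0 t) :=
      ((B.adjoint.continuous.comp_continuousOn (hc₁ x)).inner
        (B.adjoint.continuous.comp_continuousOn (hc₁ y))).sub
      ((B.adjoint.continuous.comp_continuousOn (hc₂ x)).inner
        (B.adjoint.continuous.comp_continuousOn (hc₂ y)))
    have hint := intervalIntegral.integral_eq_sub_of_hasDerivAt_of_le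
      (f := fun s => inner ℝ (R₁ s (S (t - s) x)) (S (t - s) y)
        - inner ℝ (R₂ s (S (t - s) x)) (S (t - s) y)) (f' := fun s => -q s) ht.1
      (((hc₁ x).inner (hu y)).sub ((hc₂ x).inner (hu y)))
      (fun s hs => by
        convert (h₁.hasDerivAt_orbit hS hA hx hy hs.1 hs.2 ht.2).sub
          (h₂.hasDerivAt_orbit hS hA hx hy hs.1 hs.2 ht.2) using 1
        · rfl
        · simp only [hq]
          ring)
      (hqc.neg.intervalIntegrable_of_Icc ht.1)
    simp only [h₁.initial, h₂.initial, sub_self, sub_zero, hS.map_zero,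
      ContinuousLinearMap.id_apply, ← inner_sub_left, ← sub_apply] at hint
    rw [← hint]
    have hbound : ∀ s ∈ Ioc 0 t, ‖-q s‖ ≤ (C * ‖x‖ * ‖y‖) * b s := by
      intro s hs
      have hs' : s ∈ Icc 0 T := hsub (Ioc_subset_Icc_self hs)
      have hts : t - s ∈ Icc 0 T := ⟨sub_nonneg.2 hs.2, by linarith [hs.1, ht.2]⟩
      have hb0 : 0 ≤ b s := (norm_nonneg _).trans (hbd s hs')
      rw [norm_neg]
      calc ‖q s‖ ≤ β * β * (K₁ + K₂) * ‖R₁ s - R₂ s‖ * (‖S (t - s) x‖ * ‖S (t - s) y‖) :=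
            hquad s hs' _ _
        _ ≤ β * β * (K₁ + K₂) * b s * ((M * ‖x‖) * (M * ‖y‖)) := by
            gcongr
            · exact hbd s hs'
            · exact (S (t - s)).le_of_opNorm_le (hM _ hts) x
            · exact (S (t - s)).le_of_opNorm_le (hM _ hts) y
        _ = (C * ‖x‖ * ‖y‖) * b s := by rw [hCdef]; ring
    refine (intervalIntegral.norm_integral_le_of_norm_le ht.1 (Eventually.of_forall hbound)
      ((continuous_const.mul hb).intervalIntegrable _ _)).trans_eq ?_
    rw [intervalIntegral.integral_const_mul]
    ring
  have hdense : Dense (A.domain : Set X) := hA.dense_domain hS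
  have hall : ∀ x y : X,
      ‖inner ℝ ((R₁ t - R₂ t) x) y‖ ≤ (C * ∫ s in 0..t, b s) * ‖x‖ * ‖y‖ := by
    intro x y
    have hclosed : IsClosed {p : X × X | ‖inner ℝ ((R₁ t - R₂ t) p.1) p.2‖
        ≤ (C * ∫ s in 0..t, b s) * ‖p.1‖ * ‖p.2‖} :=
      isClosed_le (by fun_prop) (by fun_prop)
    exact hclosed.closure_subset_iff.2 (fun p hp => hdom p.1 hp.1 p.2 hp.2)
      ((hdense.prod hdense) (x, y))
  refine ContinuousLinearMap.opNorm_le_bound _ (mul_nonneg hC0 hI0) fun x => ?_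
  have hx := hall x ((R₁ t - R₂ t) x)
  rw [real_inner_self_eq_norm_mul_norm, norm_mul, norm_norm] at hx
  rcases (norm_nonneg ((R₁ t - R₂ t) x)).eq_or_lt with h0 | h0
  · rw [← h0]
    positivity
  · exact le_of_mul_le_mul_right hx h0

/-! ### Uniqueness for the adjoint equation -/

theorem IsAdjointSolution.congr_riccati {f h : ℝ → X} (hR : ∀ t ∈ Icc 0 T, R₁ t = R₂ t)
    (hh : IsAdjointSolution T S B R₁ f h) : IsAdjointSolution T S B R₂ f h := by
  have hcongr : ∀ t ∈ Icc 0 T, EqOn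
      (fun s => (S (s - t)).adjoint (R₁ (T - s) (f s) - R₁ (T - s) (B (B.adjoint (h s)))))
      (fun s => (S (s - t)).adjoint (R₂ (T - s) (f s) - R₂ (T - s) (B (B.adjoint (h s)))))
      (uIcc t T) := by
    intro t ht s hs
    rw [uIcc_of_le ht.2] at hs
    simp only
    rw [hR (T - s) ⟨sub_nonneg.2 hs.2, by linarith [ht.1, hs.1]⟩]
  refine ⟨hh.continuousOn, hh.terminal, fun t ht => ?_, fun t ht => ?_⟩
  · exact (hh.integrable t ht).congr ((hcongr t ht).mono uIoc_subset_uIcc)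
  · rw [hh.equation t ht]
    exact intervalIntegral.integral_congr (hcongr t ht)

theorem IsAdjointSolution.eqOn {f h₁ h₂ : ℝ → X} (hS : IsC0Semigroup S)
    (hR : ∀ x : X, ContinuousOn (fun t => R t x) (Icc 0 T))
    (hh₁ : IsAdjointSolution T S B R f h₁) (hh₂ : IsAdjointSolution T S B R f h₂) :
    ∀ t ∈ Icc 0 T, h₁ t = h₂ t := by
  obtain ⟨M, hM0, hM⟩ := hS.exists_norm_le T
  obtain ⟨K, hK0, hK⟩ := exists_norm_le_of_strongly_continuousOn isCompact_Icc hR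
  obtain ⟨L, hL⟩ := isCompact_Icc.exists_bound_of_continuousOn
    (hh₁.continuousOn.sub hh₂.continuousOn)
  set C : ℝ := M * (K * (‖B‖ * ‖B.adjoint‖)) with hC
  have hC0 : 0 ≤ C := by positivity
  have hrev : ∀ t ∈ Icc 0 T, T - t ∈ Icc 0 T := fun t ht =>
    ⟨sub_nonneg.2 ht.2, by linarith [ht.1]⟩
  -- Gronwall's inequality in the reversed time `T - t`.
  have key : ∀ t ∈ Icc 0 T, ‖h₁ (T - t) - h₂ (T - t)‖ ≤ 0 := by
    refine nonpos_of_le_integral_of_dominated hC0 (le_max_right L 0)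
      (fun t ht => (hL _ (hrev t ht)).trans (le_max_left _ _)) ?_
    intro b hb hbd t ht
    have ht' := hrev t ht
    rw [hh₁.equation _ ht', hh₂.equation _ ht',
      ← intervalIntegral.integral_sub (hh₁.integrable _ ht') (hh₂.integrable _ ht')]
    have hbound : ∀ s ∈ Ioc (T - t) T,
        ‖(S (s - (T - t))).adjoint (R (T - s) (f s) - R (T - s) (B (B.adjoint (h₁ s))))
          - (S (s - (T - t))).adjoint (R (T - s) (f s) - R (T - s) (B (B.adjoint (h₂ s))))‖
        ≤ C * b (T - s) := by
      intro s hs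
      have hs' : s ∈ Icc 0 T := ⟨ht'.1.trans hs.1.le, hs.2⟩
      have hst : s - (T - t) ∈ Icc 0 T :=
        ⟨sub_nonneg.2 hs.1.le, by linarith [hs.2, ht'.1]⟩
      have hdiff : (S (s - (T - t))).adjoint (R (T - s) (f s) - R (T - s) (B (B.adjoint (h₁ s))))
          - (S (s - (T - t))).adjoint (R (T - s) (f s) - R (T - s) (B (B.adjoint (h₂ s))))
          = -(S (s - (T - t))).adjoint (R (T - s) (B (B.adjoint (h₁ s - h₂ s)))) := by
        simp only [map_sub]
        abel
      have hbs := hbd _ (hrev s hs')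
      rw [sub_sub_cancel] at hbs
      rw [hdiff, norm_neg]
      calc _ ≤ M * (K * (‖B‖ * (‖B.adjoint‖ * b (T - s)))) := by
            refine ContinuousLinearMap.le_of_opNorm_le_of_le _ ?_
              (ContinuousLinearMap.le_of_opNorm_le_of_le _ (hK _ (hrev s hs'))
              (ContinuousLinearMap.le_opNorm_of_le _
              (ContinuousLinearMap.le_opNorm_of_le _ hbs)))
            rw [LinearIsometryEquiv.norm_map]
            exact hM _ hst
        _ = C * b (T - s) := by rw [hC]; ring
    refine (intervalIntegral.norm_integral_le_of_norm_le ht'.2 (Eventually.of_forall hbound)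
      (Continuous.intervalIntegrable (by fun_prop) _ _)).trans_eq ?_
    rw [intervalIntegral.integral_const_mul, intervalIntegral.integral_comp_sub_left]
    simp
  intro t ht
  have := key _ (hrev t ht)
  rw [sub_sub_cancel] at this
  exact sub_eq_zero.1 (norm_le_zero_iff.1 this)

end Uniqueness

/-! ### Unitary covariance of the Riccati and the adjoint equation -/

section UnitaryConj

variable {X : Type*} [NormedAddCommGroup X] [InnerProductSpace ℝ X]

/-- The operator `V L V*`, for a unitary operator `V`. -/
def unitaryConj (V : X ≃ₗᵢ[ℝ] X) (L : X →L[ℝ] X) : X →L[ℝ] X :=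
  (V : X →L[ℝ] X).comp (L.comp (V.symm : X →L[ℝ] X))

@[simp]
theorem unitaryConj_apply (V : X ≃ₗᵢ[ℝ] X) (L : X →L[ℝ] X) (x : X) :
    unitaryConj V L x = V (L (V.symm x)) := rfl

end UnitaryConj

section Covariance

variable {X U Y Z : Type*}
  [NormedAddCommGroup X] [InnerProductSpace ℝ X] [CompleteSpace X]
  [NormedAddCommGroup U] [InnerProductSpace ℝ U] [CompleteSpace U]
  [NormedAddCommGroup Y] [InnerProductSpace ℝ Y]
  [NormedAddCommGroup Z] [InnerProductSpace ℝ Z] [CompleteSpace Z]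
  {T c : ℝ} {S S' : ℝ → X →L[ℝ] X} {A A' : X →ₗ.[ℝ] X} {B B' : U →L[ℝ] X}
  {Q Q' : X →L[ℝ] Y} {P P' : X →L[ℝ] Z} {R : ℝ → X →L[ℝ] X} {V : X ≃ₗᵢ[ℝ] X}

theorem adjoint_apply_unitary (hB : ∀ u, B' u = V (B u)) (x : X) :
    B'.adjoint x = B.adjoint (V.symm x) := by
  refine ext_inner_right ℝ fun u => ?_
  rw [ContinuousLinearMap.adjoint_inner_left, ContinuousLinearMap.adjoint_inner_left, hB,
    ← V.symm.inner_map_map x, V.symm_apply_apply]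

/-- If `R` solves the Riccati equation of `(A, B, Q, P)`, then `V R V*` solves that of
`(V A V*, V B, Q V*, P V*)`. Only `A' ⊆ V A V*` is needed, and `Q`, `P` enter only through their
quadratic forms, so that `Q'` may differ from `Q V*` by an isometry of the observation space. -/
theorem IsRiccatiSolution.conj_unitary (hR : IsRiccatiSolution T c A B Q P R)
    (hA : ∀ x y, (x, y) ∈ A'.graph → (V.symm x, V.symm y) ∈ A.graph)
    (hB : ∀ u, B' u = V (B u))
    (hQ : ∀ x y, inner ℝ (Q' x) (Q' y) = inner ℝ (Q (V.symm x)) (Q (V.symm y)))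
    (hP : ∀ x y, inner ℝ (P' x) (P' y) = inner ℝ (P (V.symm x)) (P (V.symm y))) :
    IsRiccatiSolution T c A' B' Q' P' (fun t => unitaryConj V (R t)) := by
  have hflip : ∀ x y : X, inner ℝ (V x) y = inner ℝ x (V.symm y) := V.inner_map_eq_flip
  refine ⟨fun x => ?_, fun t ht => ?_, fun x y t ht => ?_, fun x y => ?_, ?_⟩
  · exact V.continuous.comp_continuousOn (hR.continuousOn (V.symm x))
  · have h := (hR.isPositive t ht).conj_adjoint (V : X →L[ℝ] X)
    rwa [V.adjoint_eq_symm] at h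
  · obtain ⟨x', hx, -⟩ := A.mem_graph_iff.1 (hA _ _ (A'.mem_graph x))
    obtain ⟨y', hy, -⟩ := A.mem_graph_iff.1 (hA _ _ (A'.mem_graph y))
    have h := hR.differentiableAt x' y' t ht
    rw [hx, hy] at h
    simpa only [unitaryConj_apply, hflip] using h
  · obtain ⟨x', hx, hAx⟩ := A.mem_graph_iff.1 (hA _ _ (A'.mem_graph x))
    obtain ⟨y', hy, hAy⟩ := A.mem_graph_iff.1 (hA _ _ (A'.mem_graph y))
    filter_upwards [hR.equation x' y'] with t ht
    simp only at hx hy hAx hAy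
    rw [hx, hy, hAx, hAy] at ht
    simpa only [unitaryConj_apply, hflip, adjoint_apply_unitary hB, V.symm_apply_apply, hQ]
      using ht
  · ext x
    refine ext_inner_right ℝ fun y => ?_
    rw [hR.initial, unitaryConj_apply, hflip]
    simp only [smul_apply, ContinuousLinearMap.comp_apply, inner_smul_left,
      ContinuousLinearMap.adjoint_inner_left, hP]

theorem IsAdjointSolution.conj_unitary {f f' h : ℝ → X} (hh : IsAdjointSolution T S B R f h)
    (hS : ∀ t x, S' t x = V (S t (V.symm x))) (hB : ∀ u, B' u = V (B u))
    (hf : ∀ t, f' t = V (f t)) :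
    IsAdjointSolution T S' B' (fun t => unitaryConj V (R t)) f' (fun t => V (h t)) := by
  have hadj : ∀ t x, (S' t).adjoint (V x) = V ((S t).adjoint x) := by
    intro t x
    refine ext_inner_right ℝ fun y => ?_
    rw [ContinuousLinearMap.adjoint_inner_left, hS, V.inner_map_map, V.inner_map_eq_flip,
      ContinuousLinearMap.adjoint_inner_left]
  have heq : ∀ t s, (S' (s - t)).adjoint (unitaryConj V (R (T - s)) (f' s)
        - unitaryConj V (R (T - s)) (B' (B'.adjoint (V (h s)))))
      = V ((S (s - t)).adjoint (R (T - s) (f s) - R (T - s) (B (B.adjoint (h s))))) := by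
    intro t s
    simp only [unitaryConj_apply, hf, hB, adjoint_apply_unitary hB, V.symm_apply_apply,
      ← map_sub, hadj]
  refine ⟨V.continuous.comp_continuousOn hh.continuousOn, by simp [hh.terminal],
    fun t ht => ?_, fun t ht => ?_⟩
  · simp only [heq]
    have h := hh.integrable t ht
    exact ⟨(V : X →L[ℝ] X).integrable_comp h.1, (V : X →L[ℝ] X).integrable_comp h.2⟩
  · simp only [heq]
    conv_lhs => rw [hh.equation t ht]
    exact ((V : X →L[ℝ] X).intervalIntegral_comp_comm (hh.integrable t ht)).symm

end Covariance

/-! ### The extended system -/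

section Extended

variable {H : Type*} [NormedAddCommGroup H] [InnerProductSpace ℝ H]
variable {X : Type*} [NormedAddCommGroup X] [InnerProductSpace ℝ X] {N : ℕ}

@[simp]
theorem tuple_apply (F : Fin N → H →L[ℝ] X) (x : H) (i : Fin N) : tuple F x i = F i x := rfl

@[simp]
theorem coord_apply (i : Fin N) (w : HPow N H) : coord N H i w = w i := rfl

@[simp]
theorem extension_apply (z : H) (i : Fin N) : extension N H z i = z := rfl

@[simp]
theorem entrywise_apply (L : H →L[ℝ] X) (w : HPow N H) (i : Fin N) :
    entrywise N L w i = L (w i) := rfl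

@[simp]
theorem extSemigroup_apply (S : Fin N → ℝ → H →L[ℝ] H) (t : ℝ) (w : HPow N H) (i : Fin N) :
    extSemigroup S t w i = S i t (w i) := rfl

theorem mem_graph_extOp {A : Fin N → H →ₗ.[ℝ] H} {x y : HPow N H} :
    (x, y) ∈ (extOp A).graph ↔ ∀ i, (x i, y i) ∈ (A i).graph := by
  simp only [LinearPMap.mem_graph_iff]
  constructor
  · rintro ⟨w, rfl, rfl⟩ i
    exact ⟨⟨w.1 i, w.2 i⟩, rfl, rfl⟩
  · intro h
    choose w hw hAw using h
    have hmem : ∀ i, x i ∈ (A i).domain := fun i => hw i ▸ (w i).2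
    refine ⟨⟨x, hmem⟩, rfl, ?_⟩
    ext i
    rw [← hAw i]
    exact congrArg (A i) (Subtype.ext (hw i).symm)

theorem tendsto_hPow_iff {ι : Type*} {l : Filter ι} {f : ι → HPow N H} {w : HPow N H} :
    Tendsto f l (𝓝 w) ↔ ∀ i, Tendsto (fun a => f a i) l (𝓝 (w i)) := by
  rw [(PiLp.continuousLinearEquiv 2 ℝ
    (fun _ : Fin N => H)).toHomeomorph.isInducing.tendsto_nhds_iff, tendsto_pi_nhds]
  rfl

theorem isC0Semigroup_extSemigroup {S : Fin N → ℝ → H →L[ℝ] H} (hS : ∀ i, IsC0Semigroup (S i)) :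
    IsC0Semigroup (extSemigroup S) where
  map_zero := by
    ext w i
    simp [(hS i).map_zero]
  map_add s t hs ht := by
    ext w i
    simp [(hS i).map_add s t hs ht]
  continuousOn w t ht := tendsto_hPow_iff.2 fun i => (hS i).continuousOn (w i) t ht

theorem isGenerator_extOp {S : Fin N → ℝ → H →L[ℝ] H} {A : Fin N → H →ₗ.[ℝ] H}
    (hA : ∀ i, IsGenerator (S i) (A i)) : IsGenerator (extSemigroup S) (extOp A) := by
  intro x y
  rw [mem_graph_extOp, tendsto_hPow_iff]
  exact forall_congr' fun i => hA i _ _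

/-! ### Permutations of the coordinates -/

/-- The unitary operator `w ↦ (w (π 0), …, w (π (N - 1)))` of `H^N`. -/
noncomputable def permuteCoords (H : Type*) [NormedAddCommGroup H] [InnerProductSpace ℝ H]
    (π : Equiv.Perm (Fin N)) : HPow N H ≃ₗᵢ[ℝ] HPow N H :=
  LinearIsometryEquiv.piLpCongrLeft 2 ℝ H π.symm

@[simp]
theorem permuteCoords_apply (π : Equiv.Perm (Fin N)) (w : HPow N H) (i : Fin N) :
    permuteCoords H π w i = w (π i) := rfl

@[simp]
theorem permuteCoords_symm_apply (π : Equiv.Perm (Fin N)) (w : HPow N H) (i : Fin N) :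
    (permuteCoords H π).symm w i = w (π.symm i) := by
  conv_rhs => rw [← (permuteCoords H π).apply_symm_apply w]
  rw [permuteCoords_apply, π.apply_symm_apply]

theorem blockOp_permMatrix (π : Equiv.Perm (Fin N)) :
    blockOp H (π.permMatrix ℝ) = (permuteCoords H π : HPow N H →L[ℝ] HPow N H) := by
  ext w i
  simp [blockOp, Equiv.Perm.permMatrix, PEquiv.toMatrix_apply, ite_smul]

theorem blockOp_transpose_permMatrix (π : Equiv.Perm (Fin N)) :
    blockOp H (π.permMatrix ℝ).transpose
      = ((permuteCoords H π).symm : HPow N H →L[ℝ] HPow N H) := by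
  rw [Matrix.transpose_permMatrix, blockOp_permMatrix]
  ext w i
  simp

theorem extForcing_perm (A : Fin N → H →ₗ.[ℝ] H) (g g' : ℝ → H) (π : Equiv.Perm (Fin N)) (t : ℝ) :
    extForcing (fun i => A (π i)) g g' t = permuteCoords H π (extForcing A g g' t) := by
  have hdom : extension N H (g t) ∈ (extOp fun i => A (π i)).domain
      ↔ extension N H (g t) ∈ (extOp A).domain :=
    ⟨fun h i => by simpa using h (π.symm i), fun h i => h (π i)⟩
  have hval : pmapValue (extOp fun i => A (π i)) (extension N H (g t))
      = permuteCoords H π (pmapValue (extOp A) (extension N H (g t))) := by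
    unfold pmapValue
    by_cases h : extension N H (g t) ∈ (extOp A).domain
    · rw [dif_pos h, dif_pos (hdom.2 h)]
      rfl
    · rw [dif_neg h, dif_neg (mt hdom.1 h), map_zero]
  rw [extForcing, extForcing, map_sub, hval]
  rfl

theorem permuteCoords_symm_extension (π : Equiv.Perm (Fin N)) (z : H) :
    (permuteCoords H π).symm (extension N H z) = extension N H z := by
  ext i
  simp

theorem inner_entrywise_perm (L : H →L[ℝ] X) (π : Equiv.Perm (Fin N)) (x y : HPow N H) :
    inner ℝ (entrywise N L x) (entrywise N L y)
      = inner ℝ (entrywise N L ((permuteCoords H π).symm x))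
          (entrywise N L ((permuteCoords H π).symm y)) := by
  simp only [PiLp.inner_apply, entrywise_apply, permuteCoords_symm_apply]
  exact (Equiv.sum_comp π.symm fun i => inner ℝ (L (x i)) (L (y i))).symm

end Extended

section Ensemble

variable {H U Y Z : Type*}
  [NormedAddCommGroup H] [InnerProductSpace ℝ H] [CompleteSpace H]
  [NormedAddCommGroup U] [InnerProductSpace ℝ U] [CompleteSpace U]
  [NormedAddCommGroup Y] [InnerProductSpace ℝ Y] [CompleteSpace Y]
  [NormedAddCommGroup Z] [InnerProductSpace ℝ Z] [CompleteSpace Z]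
  {N : ℕ} {T : ℝ} {A : Fin N → H →ₗ.[ℝ] H} {S : Fin N → ℝ → H →L[ℝ] H} {B : U →L[ℝ] H}
  {Q : H →L[ℝ] Y} {P : H →L[ℝ] Z} {R : ℝ → HPow N H →L[ℝ] HPow N H}

theorem IsEnsembleRiccati.permute (hR : IsEnsembleRiccati T A B Q P R) (π : Equiv.Perm (Fin N)) :
    IsEnsembleRiccati T (fun i => A (π i)) B Q P
      (fun t => unitaryConj (permuteCoords H π) (R t)) := by
  refine IsRiccatiSolution.conj_unitary hR (fun x y hxy => ?_) (fun u => rfl)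
    (inner_entrywise_perm Q π) (inner_entrywise_perm P π)
  rw [mem_graph_extOp] at hxy ⊢
  intro i
  simpa using hxy (π.symm i)

theorem IsEnsembleAdjoint.permute {g g' : ℝ → H} {h : ℝ → HPow N H}
    (hh : IsEnsembleAdjoint T A S B g g' R h) (π : Equiv.Perm (Fin N)) :
    IsEnsembleAdjoint T (fun i => A (π i)) (fun i => S (π i)) B g g'
      (fun t => unitaryConj (permuteCoords H π) (R t)) (fun t => permuteCoords H π (h t)) := by
  refine IsAdjointSolution.conj_unitary hh (fun t x => ?_) (fun u => rfl)
    (extForcing_perm A g g' π)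
  ext i
  simp

end Ensemble

end EnsembleFeedback

/-- Independence of the feedback of the order of the training parameters. The ensemble `σ` is
reordered by the permutation matrix `ϑ = π.permMatrix ℝ`, whose row `i` has its entry `1` in column
`π i`, so that `ϑ σ = σ ∘ π`; `Θ = blockOp H ϑ` and `Θᵀ = blockOp H ϑᵀ`. -/
theorem mainTheorem10
    {H U Y Z 𝔖 : Type*}
    [NormedAddCommGroup H] [InnerProductSpace ℝ H] [CompleteSpace H]
    [NormedAddCommGroup U] [InnerProductSpace ℝ U] [CompleteSpace U]
    [NormedAddCommGroup Y] [InnerProductSpace ℝ Y] [CompleteSpace Y]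
    [NormedAddCommGroup Z] [InnerProductSpace ℝ Z] [CompleteSpace Z]
    (A : 𝔖 → H →ₗ.[ℝ] H) (S : 𝔖 → ℝ → H →L[ℝ] H)
    (hS : ∀ s, IsC0Semigroup (S s)) (hA : ∀ s, IsGenerator (S s) (A s))
    (B : U →L[ℝ] H) (Q : H →L[ℝ] Y) (P : H →L[ℝ] Z)
    (T : ℝ) (hT : 0 < T) (N : ℕ) (hN : 0 < N) (σ : Fin N → 𝔖)
    (g g' : ℝ → H) (hg : IsW12 T g g') (hgA : ∀ i, IsL2Domain T (A (σ i)) g)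
    (π : Equiv.Perm (Fin N))
    (R : ℝ → HPow N H →L[ℝ] HPow N H)
    (hR : IsEnsembleRiccati T (fun i => A (σ i)) B Q P R)
    (h : ℝ → HPow N H)
    (hh : IsEnsembleAdjoint T (fun i => A (σ i)) (fun i => S (σ i)) B g g' R h) :
    -- `Θ Π Θᵀ` and `Θ h` solve the Riccati and the adjoint equation of the reordered ensemble
    IsEnsembleRiccati T (fun i => A (σ (π i))) B Q P
      (fun t => (blockOp H (π.permMatrix ℝ)).comp
        ((R t).comp (blockOp H (π.permMatrix ℝ).transpose))) ∧
    IsEnsembleAdjoint T (fun i => A (σ (π i))) (fun i => S (σ (π i))) B g g'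
      (fun t => (blockOp H (π.permMatrix ℝ)).comp
        ((R t).comp (blockOp H (π.permMatrix ℝ).transpose)))
      (fun t => blockOp H (π.permMatrix ℝ) (h t)) ∧
    -- any solutions for the reordered ensemble are of this form and give the same feedback
    ∀ Rϑ : ℝ → HPow N H →L[ℝ] HPow N H,
      IsEnsembleRiccati T (fun i => A (σ (π i))) B Q P Rϑ →
      (∀ t ∈ Icc 0 T, Rϑ t = (blockOp H (π.permMatrix ℝ)).comp
        ((R t).comp (blockOp H (π.permMatrix ℝ).transpose))) ∧
      ∀ hϑ : ℝ → HPow N H,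
        IsEnsembleAdjoint T (fun i => A (σ (π i))) (fun i => S (σ (π i))) B g g' Rϑ hϑ →
        (∀ t ∈ Icc 0 T, blockOp H (π.permMatrix ℝ).transpose (hϑ t) = h t) ∧
        (∀ t ∈ Icc 0 T, ((extension N H).comp B).adjoint (hϑ t) =
          ((extension N H).comp B).adjoint (h t)) ∧
        (∀ t ∈ Icc 0 T, ∀ z : H, feedback T B Rϑ hϑ t z = feedback T B R h t z) := by
  have hR' := hR.permute π
  have hh' := hh.permute π
  have hSe := isC0Semigroup_extSemigroup fun i => hS (σ (π i))
  have hAe := isGenerator_extOp fun i => hA (σ (π i))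
  have hBΘ := adjoint_apply_unitary (V := permuteCoords H π) (B := (extension N H).comp B)
    (B' := (extension N H).comp B) fun _ => rfl
  rw [blockOp_permMatrix, blockOp_transpose_permMatrix]
  refine ⟨hR', hh', fun Rϑ hRϑ => ?_⟩
  have hRR := hRϑ.eqOn hSe hAe hR'
  refine ⟨hRR, fun hϑ hhϑ => ?_⟩
  have heq := (hhϑ.congr_riccati hRR).eqOn hSe hR'.continuousOn hh'
  have hBh : ∀ t ∈ Icc 0 T, ((extension N H).comp B).adjoint (hϑ t) =
      ((extension N H).comp B).adjoint (h t) := by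
    intro t ht
    rw [heq t ht, hBΘ, LinearIsometryEquiv.symm_apply_apply]
  refine ⟨fun t ht => ?_, hBh, fun t ht z => ?_⟩
  · rw [heq t ht]
    exact (permuteCoords H π).symm_apply_apply (h t)
  · have hBR : ((extension N H).comp B).adjoint (Rϑ (T - t) (extension N H z)) =
        ((extension N H).comp B).adjoint (R (T - t) (extension N H z)) := by
      rw [hRR (T - t) ⟨sub_nonneg.2 ht.2, by linarith [ht.1]⟩, unitaryConj_apply, hBΘ,
        LinearIsometryEquiv.symm_apply_apply, permuteCoords_symm_extension]
    rw [feedback, feedback, map_add, map_add, hBR, hBh t ht]
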